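/- \textbf{Conventions.} For a C*-algebra $A$ let $A^\infty=\ell^\infty(\mathbb N,A)/c_0(A)$, and regard $A$ as a C*-subalgebra of $A^\infty$ via classes of constant sequences. Put $D=\overline{AA^\infty A}$ (closed linear span), $N(D,A^\infty)=\{x\in A^\infty : xD+Dx\subseteq D\}$ and $\mathrm{Ann}(D,A^\infty)=\{x\in A^\infty : xd=dx=0 \text{ for all } d\in D\}$, a two-sided ideal of $N(D,A^\infty)$; write $[x]$ for the class of $x$ in $N(D,A^\infty)/\mathrm{Ann}(D,A^\infty)$. Let $P\subset A$ be an inclusion of $\sigma$-unital C*-algebras and let $E\colon A\to P$ be a faithful conditional expectation onto $P$. Put $\mathrm{Index}_p E=\bigl(\sup\{\lambda>0 : \tfrac1\lambda E-\mathrm{Id}\text{ is positive}\}\bigr)^{-1}$, with $\mathrm{Index}_pE=\infty$ if there is no such $\lambda$. If $A$ is simple and $\mathrm{Index}_pE<\infty$, let $\mathrm{Index}_w E=\widehat{E^{**}}(1)$, where $\widehat{E^{**}}$ is the normal map, dual to $E^{**}\colon A^{**}\to P^{**}$, from the basic construction of $P^{**}\subset A^{**}$ (with Jones projection $e_P$)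 to $A^{**}$ determined by $\widehat{E^{**}}(xe_Py)=xy$; it is a scalar. Equivalently, $\mathrm{Index}_wE$ is the supremum of $\bigl\|\sum_i a_ia_i^*\bigr\|$ over all finite families $(a_i)$ in $A$ with $\sum_i a_ie_Pa_i^*\le 1$, i.e. with $\sum_i E(x^*a_i)E(a_i^*x)\le E(x^*x)$ for all $x\in A$. Let $E^\infty\colon A^\infty\to P^\infty\subseteq A^\infty$ be $E^\infty([(x_n)])=[(E(x_n))]$. One says that $E$ has the \emph{Rokhlin property} if there is a positive contraction $e\in A'\cap A^\infty$ such that (i) $[e]$ is a projection in $N(D,A^\infty)/\mathrm{Ann}(D,A^\infty)$; (ii) $(\mathrm{Index}_wE)\,[E^\infty(e)]=1$ in $N(D,A^\infty)/\mathrm{Ann}(D,A^\infty)$; (iii) the map $A\ni x\mapsto [xe]\in N(D,A^\infty)/\mathrm{Ann}(D,A^\infty)$ is injective. \textbf{Theorem.} Let $P\subset A$ be an inclusion of $\sigma$-unital C*-algebras and let $E\colon A\to P$ be a faithful conditional expectation with $\mathrm{Index}_pE<\infty$ and with the Rokhlin property. Suppose that $A$ is simple. Then the inclusion map $P\to A$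 is sequentially split: there is a *-homomorphism $\psi\colon A\to P^\infty$ such that $\psi(x)=x$ for all $x\in P$, where $P$ is regarded as a subalgebra of $P^\infty$ via constant sequences. -/

import Mathlib

open Filter Topology
open scoped ENNReal

noncomputable section

/-! ### The sequence algebra `A^∞ = ℓ^∞(ℕ, A) / c₀(A)` -/

/-- The space `c₀(A)` of norm-null sequences inside `ℓ^∞(ℕ, A)`. -/
def nullSeq (A : Type*) [NonUnitalCStarAlgebra A] : Submodule ℂ (lp (fun _ : ℕ => A) ∞) where
  carrier := {x | Tendsto (fun n => ‖x n‖) atTop (𝓝 0)}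
  zero_mem' := by simp
  add_mem' := by
    intro x y hx hy
    have hx' := tendsto_zero_iff_norm_tendsto_zero.2 hx
    have hy' := tendsto_zero_iff_norm_tendsto_zero.2 hy
    refine tendsto_zero_iff_norm_tendsto_zero.1 ?_
    have h := hx'.add hy'
    rw [add_zero] at h
    exact h
  smul_mem' := by
    intro c x hx
    have hx' := tendsto_zero_iff_norm_tendsto_zero.2 hx
    refine tendsto_zero_iff_norm_tendsto_zero.1 ?_
    have h := hx'.const_smul c
    rw [smul_zero] at h
    exact h

namespace nullSeq

variable {A : Type*} [NonUnitalCStarAlgebra A]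

theorem mem_iff {x : lp (fun _ : ℕ => A) ∞} :
    x ∈ nullSeq A ↔ Tendsto (fun n => ‖x n‖) atTop (𝓝 0) := Iff.rfl

theorem mul_mem_left (x : lp (fun _ : ℕ => A) ∞) {y : lp (fun _ : ℕ => A) ∞}
    (hy : y ∈ nullSeq A) : x * y ∈ nullSeq A := by
  rw [mem_iff] at hy ⊢
  refine squeeze_zero (fun n => norm_nonneg _) (fun n => ?_) (by simpa using hy.const_mul ‖x‖)
  calc ‖(x * y) n‖ ≤ ‖x n‖ * ‖y n‖ := by simpa using norm_mul_le (x n) (y n)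
    _ ≤ ‖x‖ * ‖y n‖ := by gcongr; exact lp.norm_apply_le_norm (by simp) x n

theorem mul_mem_right (x : lp (fun _ : ℕ => A) ∞) {y : lp (fun _ : ℕ => A) ∞}
    (hy : y ∈ nullSeq A) : y * x ∈ nullSeq A := by
  rw [mem_iff] at hy ⊢
  refine squeeze_zero (fun n => norm_nonneg _) (fun n => ?_) (by simpa using hy.mul_const ‖x‖)
  calc ‖(y * x) n‖ ≤ ‖y n‖ * ‖x n‖ := by simpa using norm_mul_le (y n) (x n)
    _ ≤ ‖y n‖ * ‖x‖ := by gcongr; exact lp.norm_apply_le_norm (by simp) x n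

theorem star_mem {x : lp (fun _ : ℕ => A) ∞} (hx : x ∈ nullSeq A) : star x ∈ nullSeq A := by
  rw [mem_iff] at hx ⊢
  simpa using hx

instance isClosed : IsClosed ((nullSeq A : Submodule ℂ _) : Set (lp (fun _ : ℕ => A) ∞)) := by
  rw [← isSeqClosed_iff_isClosed]
  intro u x hu hx
  change Tendsto (fun n => ‖x n‖) atTop (𝓝 0)
  rw [Metric.tendsto_atTop]
  intro ε hε
  obtain ⟨k, hk⟩ := (Metric.tendsto_atTop.1 hx (ε / 2) (by positivity))
  obtain ⟨N, hN⟩ := Metric.tendsto_atTop.1 (hu k) (ε / 2) (by positivity)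
  refine ⟨N, fun n hn => ?_⟩
  have h1 := hk k le_rfl
  have h2 := hN n hn
  have h3 : ‖(u k - x) n‖ ≤ ‖u k - x‖ := lp.norm_apply_le_norm (by simp) _ n
  rw [dist_eq_norm] at h1
  simp only [dist_zero_right, norm_norm] at h2 ⊢
  have h4 : ‖x n‖ ≤ ‖u k n‖ + ‖(u k - x) n‖ := by
    have := norm_sub_le (u k n) ((u k - x) n)
    simpa using this
  linarith

end nullSeq

/-- The sequence algebra `A^∞ = ℓ^∞(ℕ, A) / c₀(A)`, with the quotient norm. -/
def SeqAlg (A : Type*) [NonUnitalCStarAlgebra A] : Type _ :=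
  lp (fun _ : ℕ => A) ∞ ⧸ nullSeq A

namespace SeqAlg

variable {A B : Type*} [NonUnitalCStarAlgebra A] [NonUnitalCStarAlgebra B]

instance : NormedAddCommGroup (SeqAlg A) :=
  inferInstanceAs (NormedAddCommGroup (lp (fun _ : ℕ => A) ∞ ⧸ nullSeq A))

instance : NormedSpace ℂ (SeqAlg A) :=
  inferInstanceAs (NormedSpace ℂ (lp (fun _ : ℕ => A) ∞ ⧸ nullSeq A))

instance : CompleteSpace (SeqAlg A) :=
  inferInstanceAs (CompleteSpace (lp (fun _ : ℕ => A) ∞ ⧸ nullSeq A))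

/-- The class in `A^∞` of a bounded sequence. -/
def mk (x : lp (fun _ : ℕ => A) ∞) : SeqAlg A := Submodule.Quotient.mk (p := nullSeq A) x

theorem mk_zero : mk (0 : lp (fun _ : ℕ => A) ∞) = 0 := rfl

theorem mk_add (x y : lp (fun _ : ℕ => A) ∞) : mk (x + y) = mk x + mk y := rfl

theorem mk_smul (c : ℂ) (x : lp (fun _ : ℕ => A) ∞) : mk (c • x) = c • mk x := rfl

theorem mk_surjective : Function.Surjective (mk : lp (fun _ : ℕ => A) ∞ → SeqAlg A) :=
  Submodule.Quotient.mk_surjective (nullSeq A)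

theorem mk_eq_mk {x y : lp (fun _ : ℕ => A) ∞} : mk x = mk y ↔ x - y ∈ nullSeq A :=
  Submodule.Quotient.eq _

theorem norm_mk_le (x : lp (fun _ : ℕ => A) ∞) : ‖mk x‖ ≤ ‖x‖ :=
  Submodule.Quotient.norm_mk_le _ x

theorem exists_norm_lt (x : SeqAlg A) {ε : ℝ} (hε : 0 < ε) :
    ∃ y : lp (fun _ : ℕ => A) ∞, mk y = x ∧ ‖y‖ < ‖x‖ + ε :=
  Submodule.Quotient.norm_mk_lt x hε

instance : Mul (SeqAlg A) where
  mul := Quotient.map₂ (· * ·) (by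
    intro x x' hx y y' hy
    have hx' : x - x' ∈ nullSeq A := (Submodule.quotientRel_def _).1 hx
    have hy' : y - y' ∈ nullSeq A := (Submodule.quotientRel_def _).1 hy
    refine (Submodule.quotientRel_def _).2 ?_
    have : x * y - x' * y' = x * (y - y') + (x - x') * y' := by
      rw [mul_sub, sub_mul]; abel
    rw [this]
    exact add_mem (nullSeq.mul_mem_left _ hy') (nullSeq.mul_mem_right _ hx'))

theorem mk_mul (x y : lp (fun _ : ℕ => A) ∞) : mk (x * y) = mk x * mk y := rfl

instance : Star (SeqAlg A) where
  star := Quotient.map star (by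
    intro x x' hx
    have hx' : x - x' ∈ nullSeq A := (Submodule.quotientRel_def _).1 hx
    refine (Submodule.quotientRel_def _).2 ?_
    rw [← star_sub]
    exact nullSeq.star_mem hx')

theorem mk_star (x : lp (fun _ : ℕ => A) ∞) : mk (star x) = star (mk x) := rfl

instance : NonUnitalRing (SeqAlg A) where
  left_distrib a b c := by
    obtain ⟨a, rfl⟩ := mk_surjective a
    obtain ⟨b, rfl⟩ := mk_surjective b
    obtain ⟨c, rfl⟩ := mk_surjective c
    simp only [← mk_mul, ← mk_add, mul_add]
  right_distrib a b c := by
    obtain ⟨a, rfl⟩ := mk_surjective a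
    obtain ⟨b, rfl⟩ := mk_surjective b
    obtain ⟨c, rfl⟩ := mk_surjective c
    simp only [← mk_mul, ← mk_add, add_mul]
  zero_mul a := by
    obtain ⟨a, rfl⟩ := mk_surjective a
    rw [← mk_zero, ← mk_mul, zero_mul]
  mul_zero a := by
    obtain ⟨a, rfl⟩ := mk_surjective a
    rw [← mk_zero, ← mk_mul, mul_zero]
  mul_assoc a b c := by
    obtain ⟨a, rfl⟩ := mk_surjective a
    obtain ⟨b, rfl⟩ := mk_surjective b
    obtain ⟨c, rfl⟩ := mk_surjective c
    simp only [← mk_mul, mul_assoc]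

instance : StarRing (SeqAlg A) where
  star_involutive a := by
    obtain ⟨a, rfl⟩ := mk_surjective a
    simp only [← mk_star, star_star]
  star_mul a b := by
    obtain ⟨a, rfl⟩ := mk_surjective a
    obtain ⟨b, rfl⟩ := mk_surjective b
    simp only [← mk_star, ← mk_mul, star_mul]
  star_add a b := by
    obtain ⟨a, rfl⟩ := mk_surjective a
    obtain ⟨b, rfl⟩ := mk_surjective b
    simp only [← mk_star, ← mk_add, star_add]

instance : IsScalarTower ℂ (SeqAlg A) (SeqAlg A) where
  smul_assoc c a b := by
    obtain ⟨a, rfl⟩ := mk_surjective a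
    obtain ⟨b, rfl⟩ := mk_surjective b
    simp only [smul_eq_mul, ← mk_smul, ← mk_mul, smul_mul_assoc]

instance : SMulCommClass ℂ (SeqAlg A) (SeqAlg A) where
  smul_comm c a b := by
    obtain ⟨a, rfl⟩ := mk_surjective a
    obtain ⟨b, rfl⟩ := mk_surjective b
    simp only [smul_eq_mul, ← mk_smul, ← mk_mul, mul_smul_comm]

instance : StarModule ℂ (SeqAlg A) where
  star_smul c a := by
    obtain ⟨a, rfl⟩ := mk_surjective a
    simp only [← mk_smul, ← mk_star, star_smul]

protected theorem norm_mul_le (a b : SeqAlg A) : ‖a * b‖ ≤ ‖a‖ * ‖b‖ := by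
  have key : ∀ ε : ℝ, 0 < ε → ‖a * b‖ ≤ (‖a‖ + ε) * (‖b‖ + ε) := by
    intro ε hε
    obtain ⟨x, rfl, hx⟩ := exists_norm_lt a hε
    obtain ⟨y, rfl, hy⟩ := exists_norm_lt b hε
    calc ‖mk x * mk y‖ = ‖mk (x * y)‖ := rfl
      _ ≤ ‖x * y‖ := norm_mk_le _
      _ ≤ ‖x‖ * ‖y‖ := norm_mul_le _ _
      _ ≤ _ := by gcongr
  have hlim : Tendsto (fun ε : ℝ => (‖a‖ + ε) * (‖b‖ + ε)) (𝓝[>] 0) (𝓝 (‖a‖ * ‖b‖)) := by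
    have : Continuous (fun ε : ℝ => (‖a‖ + ε) * (‖b‖ + ε)) := by fun_prop
    simpa using (this.tendsto 0).mono_left nhdsWithin_le_nhds
  exact ge_of_tendsto hlim (eventually_mem_nhdsWithin.mono fun ε hε => key ε hε)

instance : NonUnitalNormedRing (SeqAlg A) where
  __ := (inferInstance : NonUnitalRing (SeqAlg A))
  __ := (inferInstance : NormedAddCommGroup (SeqAlg A))
  norm_mul_le := SeqAlg.norm_mul_le

/-- A representative sequence may be changed on finitely many terms. -/
theorem exists_mk_eq_of_eventually_norm_le (x : lp (fun _ : ℕ => A) ∞) {C : ℝ} (hC : 0 ≤ C)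
    (h : ∀ᶠ n in atTop, ‖x n‖ ≤ C) :
    ∃ y : lp (fun _ : ℕ => A) ∞, mk y = mk x ∧ ‖y‖ ≤ C := by
  classical
  have hb : ∀ n, ‖(if ‖x n‖ ≤ C then x n else 0)‖ ≤ C := by
    intro n
    split_ifs with hn
    · exact hn
    · simpa using hC
  refine ⟨⟨fun n => if ‖x n‖ ≤ C then x n else 0, memℓp_infty ⟨C, ?_⟩⟩, ?_, ?_⟩
  · rintro _ ⟨n, rfl⟩
    exact hb n
  · rw [mk_eq_mk, nullSeq.mem_iff]
    refine tendsto_const_nhds.congr' (h.mono fun n hn => ?_)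
    change 0 = ‖(if ‖x n‖ ≤ C then x n else 0) - x n‖
    simp [hn]
  · exact lp.norm_le_of_forall_le hC hb

instance : CStarRing (SeqAlg A) where
  norm_mul_self_le a := by
    obtain ⟨x, rfl⟩ := mk_surjective a
    refine le_of_forall_pos_le_add fun ε hε => ?_
    obtain ⟨z, hz, hzn⟩ := exists_norm_lt (star (mk x) * mk x) (half_pos hε)
    set r := ‖star (mk x) * mk x‖ with hr
    have hr0 : 0 ≤ r := norm_nonneg _
    rw [← mk_star, ← mk_mul, mk_eq_mk, nullSeq.mem_iff] at hz
    have hev : ∀ᶠ n in atTop, ‖x n‖ ≤ Real.sqrt (r + ε) := by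
      filter_upwards [hz.eventually_lt_const (half_pos hε)] with n hn
      apply Real.le_sqrt_of_sq_le
      have h1 : ‖z n‖ ≤ ‖z‖ := lp.norm_apply_le_norm (by simp) z n
      have h2 : ‖star (x n) * x n‖ ≤ ‖z n‖ + ‖(z - star x * x) n‖ := by
        have h0 := norm_sub_le (z n) ((z - star x * x) n)
        have h00 : z n - (z - star x * x) n = star (x n) * x n :=
          sub_sub_cancel (z n) (star (x n) * x n)
        rwa [h00] at h0
      rw [CStarRing.norm_star_mul_self] at h2
      rw [sq]
      linarith
    obtain ⟨y, hy, hyn⟩ := exists_mk_eq_of_eventually_norm_le x (Real.sqrt_nonneg _) hev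
    have h3 : ‖mk x‖ ≤ Real.sqrt (r + ε) := by
      rw [← hy]
      exact (norm_mk_le y).trans hyn
    calc ‖mk x‖ * ‖mk x‖ ≤ Real.sqrt (r + ε) * Real.sqrt (r + ε) := by gcongr
      _ = r + ε := Real.mul_self_sqrt (by positivity)

instance : NonUnitalCStarAlgebra (SeqAlg A) where

/-- The bounded sequence with constant value `a`. -/
def constSeq (a : A) : lp (fun _ : ℕ => A) ∞ :=
  ⟨fun _ => a, memℓp_infty ⟨‖a‖, by rintro _ ⟨n, rfl⟩; exact le_rfl⟩⟩

/-- The canonical embedding of `A` into `A^∞` by classes of constant sequences. -/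
def const : A →⋆ₙₐ[ℂ] SeqAlg A where
  toFun a := mk (constSeq a)
  map_smul' _ _ := rfl
  map_zero' := rfl
  map_add' _ _ := rfl
  map_mul' _ _ := rfl
  map_star' _ := rfl

/-- The termwise image of a bounded sequence under a bounded linear map. -/
def mapSeq (f : A →L[ℂ] B) : lp (fun _ : ℕ => A) ∞ →ₗ[ℂ] lp (fun _ : ℕ => B) ∞ where
  toFun x := ⟨fun n => f (x n), memℓp_infty ⟨‖f‖ * ‖x‖, by
    rintro _ ⟨n, rfl⟩
    exact (f.le_opNorm _).trans
      (mul_le_mul_of_nonneg_left (lp.norm_apply_le_norm (by simp) x n) (norm_nonneg _))⟩⟩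
  map_add' x y := by
    ext n
    exact map_add f (x n) (y n)
  map_smul' c x := by
    ext n
    exact map_smul f c (x n)

/-- The linear map `f^∞ : A^∞ → B^∞`, `[(x_n)] ↦ [(f (x_n))]`. -/
def map (f : A →L[ℂ] B) : SeqAlg A →ₗ[ℂ] SeqAlg B :=
  (nullSeq A).mapQ (nullSeq B) (mapSeq f) (by
    intro x hx
    have hx' : Tendsto (fun n => ‖x n‖) atTop (𝓝 0) := hx
    change Tendsto (fun n => ‖f (x n)‖) atTop (𝓝 0)
    refine squeeze_zero (fun n => norm_nonneg _) (fun n => f.le_opNorm (x n)) ?_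
    simpa using hx'.const_mul ‖f‖)

theorem map_mk (f : A →L[ℂ] B) (x : lp (fun _ : ℕ => A) ∞) : map f (mk x) = mk (mapSeq f x) := rfl

end SeqAlg

/-- A `*`-homomorphism `φ : A → B` is sequentially split if there is a `*`-homomorphism
`ψ : B → A^∞` such that `ψ ∘ φ` is the canonical embedding of `A` into `A^∞`. -/
def IsSequentiallySplit {A B : Type*} [NonUnitalCStarAlgebra A] [NonUnitalCStarAlgebra B]
    (φ : A →⋆ₙₐ[ℂ] B) : Prop :=
  ∃ ψ : B →⋆ₙₐ[ℂ] SeqAlg A, ∀ a : A, ψ (φ a) = SeqAlg.const a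

/-! ### σ-unital and simple C*-algebras -/

/-- A C*-algebra is σ-unital if it has a countable approximate unit. -/
def IsSigmaUnital (A : Type*) [NonUnitalCStarAlgebra A] [PartialOrder A] : Prop :=
  ∃ u : ℕ → A, Monotone u ∧ (∀ n, 0 ≤ u n ∧ ‖u n‖ ≤ 1) ∧
    ∀ a : A, Tendsto (fun n => u n * a) atTop (𝓝 a) ∧ Tendsto (fun n => a * u n) atTop (𝓝 a)

/-- A C*-algebra is simple if it has no closed two-sided ideals other than `0` and itself. -/
def IsSimpleCStar (A : Type*) [NonUnitalCStarAlgebra A] : Prop :=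
  ∀ I : Submodule ℂ A, IsClosed (I : Set A) → (∀ a : A, ∀ x ∈ I, a * x ∈ I ∧ x * a ∈ I) →
    I = ⊥ ∨ I = ⊤

/-! ### Conditional expectations and their indices -/

section Expectation

variable {A : Type*} [NonUnitalCStarAlgebra A] [PartialOrder A]

/-- A conditional expectation of the C*-algebra `A` onto the C*-subalgebra `P`: a positive
contractive `P`-bimodule projection of `A` onto `P`. -/
structure CondExpectation (P : NonUnitalStarSubalgebra ℂ A) extends A →L[ℂ] P where
  map_coe' : ∀ p : P, toFun p = p
  map_nonneg' : ∀ a : A, 0 ≤ a → 0 ≤ (toFun a : A)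
  norm_map_le' : ∀ a : A, ‖toFun a‖ ≤ ‖a‖
  map_mul_left' : ∀ (p : P) (a : A), toFun (p * a) = p * toFun a
  map_mul_right' : ∀ (a : A) (p : P), toFun (a * p) = toFun a * p

variable {P : NonUnitalStarSubalgebra ℂ A}

instance : CoeFun (CondExpectation P) (fun _ => A → P) := ⟨fun E => E.toContinuousLinearMap⟩

namespace CondExpectation

/-- `E` is faithful if `E (a) = 0` for a positive `a` only when `a = 0`. -/
def Faithful (E : CondExpectation P) : Prop := ∀ a : A, 0 ≤ a → E a = 0 → a = 0

/-- The probabilistic index `(sup {λ > 0 : λ⁻¹ E - id is positive})⁻¹`; it is `∞` if there is no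
such `λ`. -/
def indexP (E : CondExpectation P) : ℝ≥0∞ :=
  (⨆ l ∈ {l : ℝ | 0 < l ∧ ∀ a : A, 0 ≤ a → 0 ≤ ((l⁻¹ : ℝ) : ℂ) • (E a : A) - a},
    ENNReal.ofReal l)⁻¹

/-- The operator `∑ᵢ aᵢ e_P aᵢ^*` of the basic construction, `x ↦ ∑ᵢ aᵢ E(aᵢ^* x)`, on the right
Hilbert `P`-module `A` with the `P`-valued inner product `⟨x, y⟩ = E (x^* y)`. -/
def frameOp (E : CondExpectation P) {n : ℕ} (a : Fin n → A) (x : A) : A :=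
  ∑ i, a i * (E (star (a i) * x) : A)

/-- `∑ᵢ aᵢ e_P aᵢ^* ≤ 1` as operators on the Hilbert `P`-module `A`, that is,
`⟨x, ∑ᵢ aᵢ e_P aᵢ^* x⟩ ≤ ⟨x, x⟩` for all `x`. -/
def IsSubFrame (E : CondExpectation P) {n : ℕ} (a : Fin n → A) : Prop :=
  ∀ x : A, (E (star x * E.frameOp a x) : A) ≤ (E (star x * x) : A)

/-- The index `Index_w E = Ê**(1)`, as a number. The dual map `Ê`, `Ê (x e_P y) = x y`, sends
`∑ᵢ aᵢ e_P aᵢ^*` to `∑ᵢ aᵢ aᵢ^*`. The operators `∑ᵢ aᵢ e_P aᵢ^* ≤ 1` contain an increasing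
approximate unit of the basic construction `A₁ = C*(A e_P A)`, so by normality `Ê**(1)` is the
supremum in `A**` of the elements `∑ᵢ aᵢ aᵢ^*` with `∑ᵢ aᵢ e_P aᵢ^* ≤ 1`, along an upward directed
set. If `A` is simple (and `E` has finite index) then `Ê**(1)` is a scalar multiple of the unit, and
that scalar is the supremum of the norms. -/
def indexW (E : CondExpectation P) : ℝ :=
  sSup {t : ℝ | ∃ (n : ℕ) (a : Fin n → A), E.IsSubFrame a ∧ t = ‖∑ i, a i * star (a i)‖}

end CondExpectation

end Expectation

/-! ### The normalizer of `D = closure (A A^∞ A)`, its annihilator, and their quotient -/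

section Normalizer

variable (A : Type*) [NonUnitalCStarAlgebra A]

/-- `D(A, A^∞)`, the closed linear span of `A A^∞ A` in `A^∞`. -/
def hereditaryHull : Submodule ℂ (SeqAlg A) :=
  (Submodule.span ℂ {z : SeqAlg A | ∃ (a b : A) (x : SeqAlg A),
    z = SeqAlg.const a * x * SeqAlg.const b}).topologicalClosure

/-- `N(D, A^∞) = {x ∈ A^∞ : x D + D x ⊆ D}` for `D = D(A, A^∞)`. -/
def seqNormalizer : NonUnitalSubalgebra ℂ (SeqAlg A) where
  carrier := {x | ∀ d ∈ hereditaryHull A, x * d ∈ hereditaryHull A ∧ d * x ∈ hereditaryHull A}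
  zero_mem' := by intro d _; simp
  add_mem' := by
    intro x y hx hy d hd
    rw [add_mul, mul_add]
    exact ⟨add_mem (hx d hd).1 (hy d hd).1, add_mem (hx d hd).2 (hy d hd).2⟩
  mul_mem' := by
    intro x y hx hy d hd
    constructor
    · rw [mul_assoc]
      exact (hx _ (hy d hd).1).1
    · rw [← mul_assoc]
      exact (hy _ (hx d hd).2).2
  smul_mem' := by
    intro c x hx d hd
    rw [smul_mul_assoc, mul_smul_comm]
    exact ⟨Submodule.smul_mem _ c (hx d hd).1, Submodule.smul_mem _ c (hx d hd).2⟩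

/-- `Ann(D, A^∞) = {x ∈ A^∞ : x d = d x = 0 for all d ∈ D}`, as a two-sided ideal of
`N(D, A^∞)` (it is contained in `N(D, A^∞)`). -/
def seqAnnihilator : TwoSidedIdeal (seqNormalizer A) :=
  TwoSidedIdeal.mk' {x | ∀ d ∈ hereditaryHull A, (x : SeqAlg A) * d = 0 ∧ d * (x : SeqAlg A) = 0}
    (by intro d _; simp)
    (by
      intro x y hx hy d hd
      simp [add_mul, mul_add, hx d hd, hy d hd])
    (by
      intro x hx d hd
      simp [hx d hd])
    (by
      intro x y hy d hd
      constructor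
      · simp [mul_assoc, (hy d hd).1]
      · simpa [mul_assoc] using (hy _ (x.2 d hd).2).2)
    (by
      intro x y hx d hd
      constructor
      · simpa [mul_assoc] using (hx _ (y.2 d hd).1).1
      · simp [← mul_assoc, (hx d hd).2])

/-- The quotient algebra `N(D, A^∞) / Ann(D, A^∞)`. -/
abbrev NormalizerQuotient : Type _ := (seqAnnihilator A).ringCon.Quotient

variable {A}

/-- The class `[x]` of `x ∈ N(D, A^∞)` in `N(D, A^∞) / Ann(D, A^∞)`. -/
def normalizerClass (x : seqNormalizer A) : NormalizerQuotient A := (x : NormalizerQuotient A)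

theorem mem_seqNormalizer_of_generators {y : SeqAlg A}
    (h : ∀ (a b : A) (x : SeqAlg A),
      y * (SeqAlg.const a * x * SeqAlg.const b) ∈ hereditaryHull A ∧
      (SeqAlg.const a * x * SeqAlg.const b) * y ∈ hereditaryHull A) :
    y ∈ seqNormalizer A := by
  intro d hd
  have hcl : IsClosed ((hereditaryHull A : Submodule ℂ (SeqAlg A)) : Set (SeqAlg A)) :=
    Submodule.isClosed_topologicalClosure _
  have hspan : ∀ z ∈ Submodule.span ℂ {z : SeqAlg A | ∃ (a b : A) (x : SeqAlg A),
      z = SeqAlg.const a * x * SeqAlg.const b},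
      y * z ∈ hereditaryHull A ∧ z * y ∈ hereditaryHull A := by
    intro z hz
    induction hz using Submodule.span_induction with
    | mem z hz =>
      obtain ⟨a, b, x, rfl⟩ := hz
      exact h a b x
    | zero => simp
    | add z w _ _ hz hw =>
      rw [mul_add, add_mul]
      exact ⟨add_mem hz.1 hw.1, add_mem hz.2 hw.2⟩
    | smul c z _ hz =>
      rw [mul_smul_comm, smul_mul_assoc]
      exact ⟨Submodule.smul_mem _ c hz.1, Submodule.smul_mem _ c hz.2⟩
  have hcl' : IsClosed {z : SeqAlg A | y * z ∈ hereditaryHull A ∧ z * y ∈ hereditaryHull A} :=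
    (hcl.preimage (continuous_const_mul y)).inter (hcl.preimage (continuous_mul_const y))
  exact closure_minimal hspan hcl' hd

theorem generator_mem_hereditaryHull (a b : A) (x : SeqAlg A) :
    SeqAlg.const a * x * SeqAlg.const b ∈ hereditaryHull A :=
  Submodule.le_topologicalClosure _ (Submodule.subset_span ⟨a, b, x, rfl⟩)

/-- `A ⊆ N(D, A^∞)`. -/
theorem const_mem_seqNormalizer (c : A) : SeqAlg.const c ∈ seqNormalizer A := by
  refine mem_seqNormalizer_of_generators fun a b x => ⟨?_, ?_⟩
  · have := generator_mem_hereditaryHull (c * a) b x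
    simpa [map_mul, mul_assoc] using this
  · have := generator_mem_hereditaryHull a (b * c) x
    simpa [map_mul, mul_assoc] using this

/-- `A' ∩ A^∞ ⊆ N(D, A^∞)`. -/
theorem mem_seqNormalizer_of_commute {e : SeqAlg A} (he : ∀ a : A, Commute (SeqAlg.const a) e) :
    e ∈ seqNormalizer A := by
  refine mem_seqNormalizer_of_generators fun a b x => ⟨?_, ?_⟩
  · have := generator_mem_hereditaryHull a b (e * x)
    rwa [← mul_assoc (SeqAlg.const a) e x, (he a).eq, mul_assoc e, mul_assoc e] at this
  · have := generator_mem_hereditaryHull a b (x * e)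
    rwa [mul_assoc, mul_assoc x, ← (he b).eq, ← mul_assoc x, ← mul_assoc, ← mul_assoc] at this

end Normalizer

/-! ### The Rokhlin property -/

namespace CondExpectation

variable {A : Type*} [NonUnitalCStarAlgebra A] [PartialOrder A]
  {P : NonUnitalStarSubalgebra ℂ A} [IsClosed (P : Set A)]

/-- The inclusion `P → A` as a bounded linear map. -/
def inclusionL (P : NonUnitalStarSubalgebra ℂ A) : P →L[ℂ] A where
  toFun p := p
  map_add' _ _ := rfl
  map_smul' _ _ := rfl
  cont := continuous_subtype_val

/-- `E^∞ : A^∞ → P^∞ ⊆ A^∞`, `[(x_n)] ↦ [(E (x_n))]`, as a map with values in `A^∞`. -/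
def expSeq (E : CondExpectation P) : SeqAlg A →ₗ[ℂ] SeqAlg A :=
  SeqAlg.map (inclusionL P) ∘ₗ SeqAlg.map E.toContinuousLinearMap

/-- `e ∈ A' ∩ A^∞` is a Rokhlin element for `E`. -/
structure IsRokhlinElement (E : CondExpectation P) (e : SeqAlg A) : Prop where
  /-- `e` is positive. -/
  positive : ∃ b : SeqAlg A, e = star b * b
  /-- `e` is contractive. -/
  norm_le_one : ‖e‖ ≤ 1
  /-- `e` commutes with `A`. -/
  commute : ∀ a : A, Commute (SeqAlg.const a) e
  /-- `[e]` is a projection in `N(D, A^∞) / Ann(D, A^∞)`; it is self-adjoint because `e` is. -/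
  isIdempotent : IsIdempotentElem (normalizerClass ⟨e, mem_seqNormalizer_of_commute commute⟩)
  /-- `(Index_w E) [E^∞ (e)]` is the unit of `N(D, A^∞) / Ann(D, A^∞)`. -/
  index_mul : ∃ h : E.expSeq e ∈ seqNormalizer A, ∀ y : NormalizerQuotient A,
    normalizerClass ((E.indexW : ℂ) • ⟨E.expSeq e, h⟩) * y = y ∧
    y * normalizerClass ((E.indexW : ℂ) • ⟨E.expSeq e, h⟩) = y
  /-- The map `x ↦ [x e]` is injective on `A`. -/
  injective : Function.Injective fun x : A =>
    normalizerClass ⟨SeqAlg.const x * e, (seqNormalizer A).mul_mem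
      (const_mem_seqNormalizer x) (mem_seqNormalizer_of_commute commute)⟩

/-- `E` has the Rokhlin property if it has a Rokhlin element. -/
def HasRokhlinProperty (E : CondExpectation P) : Prop := ∃ e : SeqAlg A, E.IsRokhlinElement e

end CondExpectation

end

/-!
Let `e` be a Rokhlin element and `w = Index_w E`. The splitting is `ψ (x) = w E^∞ (e x)`. It restricts
to the canonical embedding on `P` because `E^∞` is a `P`-bimodule map and `w E^∞ (e)` acts on `A` as
a unit. That it is multiplicative rests on the push-down identity
`e z = w e E^∞ (e z)` for `z ∈ A` (`const_mul_pushDown`), which holds after multiplication by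
elements of `A`: it gives
`ψ (x) ψ (z) = w E^∞ (x · w e E^∞ (e z)) = w E^∞ (x e z) = ψ (x z)`.

In the basic construction the push-down identity says that the projection `w e e_P e ≤ e` is equal
to `e`, and the reason is that both have the same image under the dual map of `E`. Here this is
derived from the definition of the index as a supremum. If the vector `b = e z - w e E^∞ (e z)` were
nonzero, then `√w e p`, with `p` far out in an approximate unit of `P`, and a small multiple `c b`
would be orthogonal vectors of length at most one, hence a subframe (`isSubFrame_of_gram_le`,
`norm_pair_le_of_expSeq`). The definition of `w` bounds `w e p p^* e + c² b b^*` by `w`. Compressed to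
the projection `e`, the first summand tends to `w e`, so nothing is left for `b` (`norm_sq_le`).
That an approximate unit of `P` is one of `A` follows from `w E^∞ (e)` being a unit for `A`
(`tendsto_mul_approximateUnit`).
-/

noncomputable section

/-! ### The conditional expectation as a map of `A` into itself -/

namespace CondExpectation

variable {A : Type*} [NonUnitalCStarAlgebra A] [PartialOrder A]
  {P : NonUnitalStarSubalgebra ℂ A}

/-- The conditional expectation, viewed as a bounded linear map of `A` into itself. -/
def toSelf (E : CondExpectation P) : A →L[ℂ] A where
  toFun a := E a
  map_add' a b := congrArg Subtype.val (map_add E.toContinuousLinearMap a b)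
  map_smul' c a := congrArg Subtype.val (map_smul E.toContinuousLinearMap c a)
  cont := continuous_subtype_val.comp E.toContinuousLinearMap.continuous

theorem toSelf_apply (E : CondExpectation P) (a : A) : E.toSelf a = (E a : A) := rfl

theorem norm_toSelf_le (E : CondExpectation P) (a : A) : ‖E.toSelf a‖ ≤ ‖a‖ := E.norm_map_le' a

theorem toSelf_nonneg (E : CondExpectation P) {a : A} (ha : 0 ≤ a) : 0 ≤ E.toSelf a :=
  E.map_nonneg' a ha

theorem toSelf_coe_mul (E : CondExpectation P) (p : P) (a : A) :
    E.toSelf (p * a) = p * E.toSelf a :=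
  congrArg Subtype.val (E.map_mul_left' p a)

theorem toSelf_mul_coe (E : CondExpectation P) (a : A) (p : P) :
    E.toSelf (a * p) = E.toSelf a * p :=
  congrArg Subtype.val (E.map_mul_right' a p)

theorem toSelf_toSelf_mul (E : CondExpectation P) (a b : A) :
    E.toSelf (E.toSelf a * b) = E.toSelf a * E.toSelf b :=
  E.toSelf_coe_mul (E a) b

theorem toSelf_mul_toSelf (E : CondExpectation P) (a b : A) :
    E.toSelf (a * E.toSelf b) = E.toSelf a * E.toSelf b :=
  E.toSelf_mul_coe a (E b)

theorem toSelf_star [StarOrderedRing A] (E : CondExpectation P) (a : A) :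
    E.toSelf (star a) = star (E.toSelf a) :=
  map_star (PositiveLinearMap.mk₀ (E.toSelf : A →ₗ[ℂ] A) fun _ h => E.toSelf_nonneg h) a

theorem toSelf_real_smul (E : CondExpectation P) (r : ℝ) (a : A) :
    E.toSelf (r • a) = r • E.toSelf a := E.toSelf.map_smul_of_tower r a

/-! ### Two-element subframes -/

theorem isSubFrame_pair_iff (E : CondExpectation P) [StarOrderedRing A] (a b : A) :
    E.IsSubFrame ![a, b] ↔ ∀ x : A,
      star (E.toSelf (star a * x)) * E.toSelf (star a * x) +
        star (E.toSelf (star b * x)) * E.toSelf (star b * x) ≤ E.toSelf (star x * x) := by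
  refine forall_congr' fun x => ?_
  rw [← E.toSelf_apply, ← E.toSelf_apply, frameOp]
  simp only [Fin.sum_univ_two, Matrix.cons_val_zero, Matrix.cons_val_one, ← E.toSelf_apply,
    mul_add, map_add, ← mul_assoc, toSelf_mul_toSelf, ← toSelf_star, star_mul, star_star]

/-- The operator `a e_P a^* + b e_P b^*` has norm at most that of the Gram matrix of `(a, b)`, and
an upper bound for the latter is `M + δ` when the diagonal entries are bounded by `M` and the
off-diagonal ones by `δ`. After rescaling, `(a, b)` is therefore a subframe. -/
theorem isSubFrame_of_gram_le [StarOrderedRing A] (E : CondExpectation P) {a b : A} {M δ s : ℝ}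
    (hδ : 0 < δ) (ha : ‖E.toSelf (star a * a)‖ ≤ M) (hb : ‖E.toSelf (star b * b)‖ ≤ M)
    (hab : ‖E.toSelf (star a * b)‖ ≤ δ) (hs : s ^ 2 * (M + δ) = 1) :
    E.IsSubFrame ![s • a, s • b] := by
  rw [isSubFrame_pair_iff]
  intro x
  set g := E.toSelf (star a * x) with hg
  set k := E.toSelf (star b * x) with hk
  set h := E.toSelf (star a * b) with hh
  have hga : E.toSelf (star x * a) = star g := by rw [hg, ← toSelf_star]; simp
  have hkb : E.toSelf (star x * b) = star k := by rw [hk, ← toSelf_star]; simp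
  have hhb : E.toSelf (star b * a) = star h := by rw [hh, ← toSelf_star]; simp
  have hMK : 0 ≤ M := (norm_nonneg _).trans ha
  -- the diagonal terms of `⟨Tx, Tx⟩`, with `T = a e_P a^* + b e_P b^*`
  have h1 : star g * E.toSelf (star a * a) * g ≤ M • (star g * g) :=
    (CStarAlgebra.star_left_conjugate_le_norm_smul
      (E.toSelf_nonneg (star_mul_self_nonneg a)).isSelfAdjoint).trans
      (smul_le_smul_of_nonneg_right ha (star_mul_self_nonneg g))
  have h2 : star k * E.toSelf (star b * b) * k ≤ M • (star k * k) :=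
    (CStarAlgebra.star_left_conjugate_le_norm_smul
      (E.toSelf_nonneg (star_mul_self_nonneg b)).isSelfAdjoint).trans
      (smul_le_smul_of_nonneg_right hb (star_mul_self_nonneg k))
  -- the off-diagonal terms, by expanding `0 ≤ (δ g - h k)^* (δ g - h k)`
  have h3 : star g * h * k + star k * star h * g ≤ δ • (star g * g + star k * k) := by
    have e1 : star k * (star h * h) * k ≤ (δ ^ 2) • (star k * k) := by
      refine (CStarAlgebra.star_left_conjugate_le_norm_smul
        (IsSelfAdjoint.star_mul_self h)).trans
        (smul_le_smul_of_nonneg_right ?_ (star_mul_self_nonneg k))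
      rw [CStarRing.norm_star_mul_self, sq]
      gcongr
    have e2 := star_mul_self_nonneg (δ • g - h * k)
    have e3 : star (δ • g - h * k) * (δ • g - h * k) = δ ^ 2 • (star g * g)
        - δ • (star g * h * k + star k * star h * g) + star k * (star h * h) * k := by
      simp only [star_sub, star_smul, star_trivial, star_mul, sub_mul, mul_sub, smul_mul_assoc,
        mul_smul_comm, mul_assoc, sq]
      module
    rw [e3] at e2
    have e4 : δ • (star g * h * k + star k * star h * g) ≤
        δ • (δ • (star g * g + star k * k)) := by
      rw [← sub_nonneg] at e1 ⊢
      convert add_nonneg e1 e2 using 1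
      module
    exact le_of_smul_le_smul_left e4 hδ
  set S := star g * g + star k * k with hS
  have h4 : star g * E.toSelf (star a * a) * g + star k * E.toSelf (star b * b) * k
      + (star g * h * k + star k * star h * g) ≤ (M + δ) • S := by
    rw [← sub_nonneg] at h1 h2 h3 ⊢
    convert add_nonneg (add_nonneg h1 h2) h3 using 1
    module
  -- positivity of `⟨x - s² Tx, x - s² Tx⟩` gives `s² ⟨x, Tx⟩ ≤ ⟨x, x⟩`, as `⟨Tx, Tx⟩ ≤ s⁻² ⟨x, Tx⟩`
  have h5 : E.toSelf (star (x - s ^ 2 • (a * g + b * k)) * (x - s ^ 2 • (a * g + b * k))) =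
      E.toSelf (star x * x) - (2 * s ^ 2) • S + (s ^ 2 * s ^ 2) •
      (star g * E.toSelf (star a * a) * g + star k * E.toSelf (star b * b) * k
      + (star g * h * k + star k * star h * g)) := by
    have r1 (y z : A) : E.toSelf (y * (z * g)) = E.toSelf (y * z) * g := by
      rw [← mul_assoc, hg, toSelf_mul_toSelf]
    have r2 (y z : A) : E.toSelf (y * (z * k)) = E.toSelf (y * z) * k := by
      rw [← mul_assoc, hk, toSelf_mul_toSelf]
    have l1 (y : A) : E.toSelf (star g * y) = star g * E.toSelf y := by
      rw [hg, ← toSelf_star, toSelf_toSelf_mul]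
    have l2 (y : A) : E.toSelf (star k * y) = star k * E.toSelf y := by
      rw [hk, ← toSelf_star, toSelf_toSelf_mul]
    simp only [star_sub, star_add, star_smul, star_trivial, star_mul, sub_mul, mul_sub, add_mul,
      mul_add, smul_mul_assoc, mul_smul_comm, map_sub, map_add, toSelf_real_smul, mul_assoc, l1, l2,
      r1, r2, hga, hkb, hhb, ← hh, ← hg, ← hk, hS]
    module
  have h6 := E.toSelf_nonneg (star_mul_self_nonneg (x - s ^ 2 • (a * g + b * k)))
  rw [h5] at h6
  simp only [star_smul, star_trivial, smul_mul_assoc, toSelf_real_smul, mul_smul_comm, ← hg, ← hk]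
  have h7 := smul_le_smul_of_nonneg_left h4 (by positivity : 0 ≤ s ^ 2 * s ^ 2)
  rw [smul_smul, mul_assoc (s ^ 2), hs, mul_one] at h7
  rw [← sub_nonneg] at h7 ⊢
  convert add_nonneg h6 h7 using 1
  rw [hS]
  module

theorem indexW_nonneg (E : CondExpectation P) : 0 ≤ E.indexW := by
  refine Real.sSup_nonneg ?_
  rintro _ ⟨n, a, -, rfl⟩
  exact norm_nonneg _

theorem norm_pair_le_indexW (E : CondExpectation P) (hw : E.indexW ≠ 0) {a b : A}
    (h : E.IsSubFrame ![a, b]) : ‖a * star a + b * star b‖ ≤ E.indexW := by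
  -- an unbounded set has supremum `0` by convention
  have hbdd : BddAbove {t : ℝ | ∃ (n : ℕ) (a : Fin n → A),
      E.IsSubFrame a ∧ t = ‖∑ i, a i * star (a i)‖} := by
    by_contra hb
    exact hw (Real.sSup_of_not_bddAbove hb)
  exact le_csSup hbdd ⟨2, ![a, b], h, by simp [Fin.sum_univ_two]⟩

theorem norm_pair_le_of_gram_le [StarOrderedRing A] (E : CondExpectation P) (hw : E.indexW ≠ 0)
    {a b : A} {M δ : ℝ} (hδ : 0 < δ) (ha : ‖E.toSelf (star a * a)‖ ≤ M)
    (hb : ‖E.toSelf (star b * b)‖ ≤ M) (hab : ‖E.toSelf (star a * b)‖ ≤ δ) :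
    ‖a * star a + b * star b‖ ≤ E.indexW * (M + δ) := by
  have hM : 0 ≤ M := (norm_nonneg _).trans ha
  have hK : 0 < M + δ := by positivity
  set s := (Real.sqrt (M + δ))⁻¹ with hs
  have hsq : s ^ 2 = (M + δ)⁻¹ := by rw [hs, inv_pow, Real.sq_sqrt hK.le]
  have h := E.norm_pair_le_indexW hw (E.isSubFrame_of_gram_le (s := s) hδ ha hb hab
    (by rw [hsq, inv_mul_cancel₀ hK.ne']))
  simp only [star_smul, star_trivial, smul_mul_assoc, mul_smul_comm, smul_smul] at h
  rw [← smul_add, norm_smul, ← sq, hsq, Real.norm_of_nonneg (by positivity),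
    inv_mul_le_iff₀ hK] at h
  linarith

end CondExpectation

/-! ### The expectation on the sequence algebra -/

namespace SeqAlg

variable {A : Type*} [NonUnitalCStarAlgebra A]

theorem eventually_norm_lt {x : lp (fun _ : ℕ => A) ∞} {C : ℝ} (h : ‖mk x‖ < C) :
    ∀ᶠ n in atTop, ‖x n‖ < C := by
  obtain ⟨y, hy, hyC⟩ := exists_norm_lt (mk x) (sub_pos.2 h)
  rw [add_sub_cancel] at hyC
  rw [eq_comm, mk_eq_mk, nullSeq.mem_iff] at hy
  filter_upwards [hy.eventually_lt_const (sub_pos.2 hyC)] with n hn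
  have h1 : ‖y n‖ ≤ ‖y‖ := lp.norm_apply_le_norm (by simp) y n
  have h2 : ‖x n‖ ≤ ‖(x - y) n‖ + ‖y n‖ := by simpa using norm_add_le ((x - y) n) (y n)
  linarith

theorem norm_mk_le_of_eventually {x : lp (fun _ : ℕ => A) ∞} {C : ℝ} (hC : 0 ≤ C)
    (h : ∀ᶠ n in atTop, ‖x n‖ ≤ C) : ‖mk x‖ ≤ C := by
  obtain ⟨y, hy, hyC⟩ := exists_mk_eq_of_eventually_norm_le x hC h
  exact hy ▸ (norm_mk_le y).trans hyC

theorem norm_const_le (a : A) : ‖const a‖ ≤ ‖a‖ :=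
  norm_mk_le_of_eventually (norm_nonneg a) (Eventually.of_forall fun _ => le_rfl)

theorem continuous_const : Continuous (const : A → SeqAlg A) :=
  AddMonoidHomClass.continuous_of_bound (const : A →⋆ₙₐ[ℂ] SeqAlg A) 1
    fun a => by simpa using norm_const_le a

theorem const_injective : Function.Injective (const : A → SeqAlg A) := by
  rw [injective_iff_map_eq_zero]
  intro a ha
  have h : constSeq a - 0 ∈ nullSeq A := mk_eq_mk.1 ha
  rw [sub_zero, nullSeq.mem_iff] at h
  exact norm_eq_zero.1 (tendsto_nhds_unique tendsto_const_nhds h)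

end SeqAlg

namespace CondExpectation

open SeqAlg

variable {A : Type*} [NonUnitalCStarAlgebra A] [PartialOrder A]
  {P : NonUnitalStarSubalgebra ℂ A} [IsClosed (P : Set A)]

theorem expSeq_mk (E : CondExpectation P) (x : lp (fun _ : ℕ => A) ∞) :
    E.expSeq (SeqAlg.mk x) = SeqAlg.mk (mapSeq E.toSelf x) := rfl

theorem expSeq_star [StarOrderedRing A] (E : CondExpectation P) (x : SeqAlg A) :
    E.expSeq (star x) = star (E.expSeq x) := by
  obtain ⟨x, rfl⟩ := mk_surjective x
  rw [← mk_star, expSeq_mk, expSeq_mk, ← mk_star]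
  exact congrArg SeqAlg.mk (lp.ext (funext fun n => E.toSelf_star (x n)))

theorem expSeq_mul_expSeq (E : CondExpectation P) (x y : SeqAlg A) :
    E.expSeq (x * E.expSeq y) = E.expSeq x * E.expSeq y := by
  obtain ⟨x, rfl⟩ := mk_surjective x
  obtain ⟨y, rfl⟩ := mk_surjective y
  simp only [expSeq_mk, ← mk_mul]
  exact congrArg SeqAlg.mk (lp.ext (funext fun n => E.toSelf_mul_toSelf (x n) (y n)))

theorem expSeq_const_mul (E : CondExpectation P) (p : P) (x : SeqAlg A) :
    E.expSeq (const (p : A) * x) = const (p : A) * E.expSeq x := by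
  obtain ⟨x, rfl⟩ := mk_surjective x
  change E.expSeq (SeqAlg.mk _ * SeqAlg.mk x) = SeqAlg.mk _ * _
  simp only [expSeq_mk, ← mk_mul]
  exact congrArg SeqAlg.mk (lp.ext (funext fun n => E.toSelf_coe_mul p (x n)))

theorem expSeq_mul_const (E : CondExpectation P) (x : SeqAlg A) (p : P) :
    E.expSeq (x * const (p : A)) = E.expSeq x * const (p : A) := by
  obtain ⟨x, rfl⟩ := mk_surjective x
  change E.expSeq (SeqAlg.mk x * SeqAlg.mk _) = _ * SeqAlg.mk _
  simp only [expSeq_mk, ← mk_mul]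
  exact congrArg SeqAlg.mk (lp.ext (funext fun n => E.toSelf_mul_coe (x n) p))

theorem norm_expSeq_le (E : CondExpectation P) (x : SeqAlg A) : ‖E.expSeq x‖ ≤ ‖x‖ := by
  refine le_of_forall_pos_lt_add fun ε hε => ?_
  obtain ⟨y, rfl, hy⟩ := exists_norm_lt x hε
  refine ((norm_mk_le _).trans (lp.norm_le_of_forall_le (norm_nonneg y) fun n => ?_)).trans_lt hy
  exact (E.norm_toSelf_le (y n)).trans (lp.norm_apply_le_norm (by simp) y n)

theorem expSeq_real_smul (E : CondExpectation P) (r : ℝ) (x : SeqAlg A) :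
    E.expSeq (r • x) = r • E.expSeq x := E.expSeq.map_smul_of_tower r x

/-- The defining property of the index passes to the sequence algebra: a pair of
orthogonal vectors of length at most `1` in `A^∞` lifts to pairs in `A` whose Gram matrices are
asymptotically bounded by `1`. -/
theorem norm_pair_le_of_expSeq [StarOrderedRing A] (E : CondExpectation P) (hw : E.indexW ≠ 0)
    {a b : SeqAlg A} (ha : ‖E.expSeq (star a * a)‖ ≤ 1) (hb : ‖E.expSeq (star b * b)‖ ≤ 1)
    (hab : E.expSeq (star a * b) = 0) : ‖a * star a + b * star b‖ ≤ E.indexW := by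
  obtain ⟨a, rfl⟩ := mk_surjective a
  obtain ⟨b, rfl⟩ := mk_surjective b
  have key : ∀ δ : ℝ, 0 < δ → ‖SeqAlg.mk a * star (SeqAlg.mk a) + SeqAlg.mk b * star (SeqAlg.mk b)‖ ≤
      E.indexW * (1 + δ + δ) := by
    intro δ hδ
    have ha' := eventually_norm_lt (x := mapSeq E.toSelf (star a * a))
      (ha.trans_lt (lt_add_of_pos_right 1 hδ))
    have hb' := eventually_norm_lt (x := mapSeq E.toSelf (star b * b))
      (hb.trans_lt (lt_add_of_pos_right 1 hδ))
    have hab' := eventually_norm_lt (x := mapSeq E.toSelf (star a * b)) (C := δ)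
      ((norm_eq_zero.2 hab).trans_lt hδ)
    refine norm_mk_le_of_eventually (x := a * star a + b * star b)
      (mul_nonneg E.indexW_nonneg (by positivity)) ?_
    filter_upwards [ha', hb', hab'] with n h1 h2 h3
    exact E.norm_pair_le_of_gram_le hw hδ h1.le h2.le h3.le
  have hlim : Tendsto (fun δ : ℝ => E.indexW * (1 + δ + δ)) (𝓝[>] 0) (𝓝 E.indexW) := by
    have : Continuous (fun δ : ℝ => E.indexW * (1 + δ + δ)) := by fun_prop
    simpa using (this.tendsto 0).mono_left nhdsWithin_le_nhds
  exact ge_of_tendsto hlim (eventually_mem_nhdsWithin.mono fun δ hδ => key δ hδ)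

end CondExpectation

/-! ### The normalizer quotient -/

section Quotient

open SeqAlg

variable {A : Type*} [NonUnitalCStarAlgebra A]

/-- `A ⊆ D (A, A^∞)`. -/
theorem const_mem_hereditaryHull [PartialOrder A] (hA : IsSigmaUnital A) (a : A) :
    const a ∈ hereditaryHull A := by
  obtain ⟨u, -, -, hu⟩ := hA
  have hcl : IsClosed ((hereditaryHull A : Submodule ℂ (SeqAlg A)) : Set (SeqAlg A)) :=
    Submodule.isClosed_topologicalClosure _
  have h1 (n : ℕ) : const (u n * a) ∈ hereditaryHull A := by
    refine hcl.mem_of_tendsto ((SeqAlg.continuous_const.tendsto _).comp (hu (u n * a)).2)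
      (Eventually.of_forall fun m => ?_)
    simpa [map_mul] using generator_mem_hereditaryHull (u n) (u m) (const a)
  exact hcl.mem_of_tendsto ((SeqAlg.continuous_const.tendsto _).comp (hu a).1) (Eventually.of_forall h1)

/-- Two elements with the same class agree as left and right multipliers of `A`. -/
theorem mul_const_eq_of_normalizerClass_eq [PartialOrder A] (hA : IsSigmaUnital A)
    {x y : seqNormalizer A} (h : normalizerClass x = normalizerClass y) (a : A) :
    (x : SeqAlg A) * const a = y * const a ∧ const a * (x : SeqAlg A) = const a * y := by
  have h1 : x - y ∈ seqAnnihilator A := by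
    rw [← TwoSidedIdeal.rel_iff]
    exact (RingCon.eq _).1 h
  rw [seqAnnihilator, TwoSidedIdeal.mem_mk'] at h1
  have h2 := h1 (const a) (const_mem_hereditaryHull hA a)
  simpa [sub_mul, mul_sub, sub_eq_zero] using h2

end Quotient

/-! ### Rokhlin elements and the push-down identity -/

namespace CondExpectation

open SeqAlg

variable {A : Type*} [NonUnitalCStarAlgebra A] [PartialOrder A]
  {P : NonUnitalStarSubalgebra ℂ A} [IsClosed (P : Set A)]

namespace IsRokhlinElement

variable {E : CondExpectation P} {e : SeqAlg A}

theorem star_eq (he : E.IsRokhlinElement e) : star e = e := by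
  obtain ⟨b, rfl⟩ := he.positive
  simp

theorem normalizerClass_mul_self (he : E.IsRokhlinElement e) :
    normalizerClass (⟨e, mem_seqNormalizer_of_commute he.commute⟩ *
      ⟨e, mem_seqNormalizer_of_commute he.commute⟩) =
      normalizerClass ⟨e, mem_seqNormalizer_of_commute he.commute⟩ := he.isIdempotent

theorem mul_mul_const (he : E.IsRokhlinElement e) (hA : IsSigmaUnital A) (a : A) :
    e * (e * const a) = e * const a := by
  rw [← mul_assoc]
  exact (mul_const_eq_of_normalizerClass_eq hA he.normalizerClass_mul_self a).1

theorem const_mul_mul (he : E.IsRokhlinElement e) (hA : IsSigmaUnital A) (a : A) (y : SeqAlg A) :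
    const a * (e * (e * y)) = const a * (e * y) := by
  have h : const a * (e * e) = const a * e :=
    (mul_const_eq_of_normalizerClass_eq hA he.normalizerClass_mul_self a).2
  rw [← mul_assoc e, ← mul_assoc, h, mul_assoc]

theorem expSeq_mul_const (he : E.IsRokhlinElement e) (hA : IsSigmaUnital A) (a : A) :
    E.indexW • (E.expSeq e * const a) = const a := by
  obtain ⟨h, hy⟩ := he.index_mul
  have key (b c : A) : E.indexW • (E.expSeq e * const (b * c)) = const (b * c) := by
    have h1 := (mul_const_eq_of_normalizerClass_eq hA
      (x := ((E.indexW : ℂ) • ⟨E.expSeq e, h⟩) * ⟨const b, const_mem_seqNormalizer b⟩)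
      (hy (normalizerClass ⟨const b, const_mem_seqNormalizer b⟩)).1 c).1
    simpa [map_mul, mul_assoc, smul_mul_assoc] using h1
  obtain ⟨u, -, -, hu⟩ := hA
  have hc := (SeqAlg.continuous_const.tendsto a).comp (hu a).1
  refine tendsto_nhds_unique (((continuous_const_mul (E.expSeq e)).const_smul
    E.indexW).continuousAt.tendsto.comp hc) (hc.congr fun n => (key (u n) a).symm)

theorem const_mul_expSeq [StarOrderedRing A] (he : E.IsRokhlinElement e) (hA : IsSigmaUnital A)
    (a : A) : E.indexW • (const a * E.expSeq e) = const a := by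
  have h := congrArg star (he.expSeq_mul_const hA (star a))
  simpa [← map_star, ← E.expSeq_star, he.star_eq] using h

/-- In the presence of a Rokhlin element the index vanishes only if `A = 0`. So for `A ≠ 0` the
supremum defining it is a genuine one, and not the conventional value `0` of an unbounded set. -/
theorem eq_zero_of_indexW_eq_zero (he : E.IsRokhlinElement e) (hA : IsSigmaUnital A)
    (hw : E.indexW = 0) (a : A) : a = 0 := by
  refine const_injective ?_
  rw [← he.expSeq_mul_const hA a, hw, zero_smul, map_zero]

/-- Since `Index_w E • E^∞ (e)` acts as a unit on `A`, the set `A P` is dense in `A`; hence an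
approximate unit of `P` is one of `A`. -/
theorem tendsto_mul_approximateUnit [StarOrderedRing A] (he : E.IsRokhlinElement e)
    (hA : IsSigmaUnital A) {u : ℕ → P} (hu : ∀ n, ‖u n‖ ≤ 1)
    (hu' : ∀ p : P, Tendsto (fun n => p * u n) atTop (𝓝 p)) (a : A) :
    Tendsto (fun n => a * (u n : A)) atTop (𝓝 a) := by
  have hden (ε : ℝ) (hε : 0 < ε) : ∃ (b : A) (p : P), ‖b * p - a‖ < ε := by
    have h := he.const_mul_expSeq hA a
    obtain ⟨f, rfl⟩ := mk_surjective e
    have h' : SeqAlg.mk (E.indexW • (constSeq a * mapSeq E.toSelf f)) =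
      SeqAlg.mk (constSeq a) := h
    rw [mk_eq_mk, nullSeq.mem_iff] at h'
    obtain ⟨n, hn⟩ := (h'.eventually_lt_const hε).exists
    refine ⟨E.indexW • a, E (f n), ?_⟩
    rw [smul_mul_assoc]
    exact hn
  rw [Metric.tendsto_atTop]
  intro ε hε
  obtain ⟨b, p, hbp⟩ := hden (ε / 3) (by positivity)
  have h1 : Tendsto (fun n => b * ((p * u n : P) : A)) atTop (𝓝 (b * p)) :=
    ((continuous_const_mul b).comp continuous_subtype_val).continuousAt.tendsto.comp (hu' p)
  obtain ⟨N, hN⟩ := Metric.tendsto_atTop.1 h1 (ε / 3) (by positivity)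
  refine ⟨N, fun n hn => ?_⟩
  have h2 := hN n hn
  rw [dist_eq_norm] at h2 ⊢
  have h3 : ‖(b * p - a) * (u n : A)‖ ≤ ‖b * p - a‖ :=
    (norm_mul_le _ _).trans (mul_le_of_le_one_right (norm_nonneg _) (hu n))
  have h4 : a * (u n : A) - a = (b * ((p * u n : P) : A) - b * p) + (b * p - a)
      - (b * p - a) * (u n : A) := by
    push_cast
    noncomm_ring
  rw [h4]
  have h5 := norm_sub_le ((b * ((p * u n : P) : A) - b * p) + (b * p - a))
    ((b * p - a) * (u n : A))
  have h6 := norm_add_le (b * ((p * u n : P) : A) - b * p) (b * p - a)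
  linarith

/-- Maximality of the index: with `α = √(Index_w E) e p` and a multiple `β` of `b`, the pair
`(α, β)` is subject to `‖α α^* + β β^*‖ ≤ Index_w E`. Compressed by `x e`, the first summand already
exhausts this bound up to the part of `x x^*` not captured by `p`. -/
theorem norm_sq_le [StarOrderedRing A] (he : E.IsRokhlinElement e) (hA : IsSigmaUnital A)
    (hw : E.indexW ≠ 0) (x : A) (p : P) (hp : ‖p‖ ≤ 1) (b : SeqAlg A)
    (hb : E.expSeq (const ((star p : P) : A) * (e * b)) = 0) :
    ‖const x * (e * b)‖ ^ 2 ≤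
      E.indexW * (‖b‖ + 1) ^ 2 * ‖x * star x - x * p * star (x * p)‖ := by
  let _ := CStarAlgebra.spectralOrder (SeqAlg A)
  have := CStarAlgebra.spectralOrderedRing (SeqAlg A)
  set w := E.indexW with hwdef
  have hw0 : 0 ≤ w := E.indexW_nonneg
  have hsq : Real.sqrt w * Real.sqrt w = w := Real.mul_self_sqrt hw0
  have hse := he.star_eq
  -- `β = r b` has length at most `1`
  set r : ℝ := (‖b‖ + 1)⁻¹ with hr
  have hr0 : 0 < r := by positivity
  have hrb : r * ‖b‖ ≤ 1 := by
    rw [hr, inv_mul_le_iff₀ (by positivity)]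
    linarith
  have hstar : const ((star p : P) : A) = star (const (p : A)) := map_star const (p : A)
  set α : SeqAlg A := Real.sqrt w • (e * const (p : A)) with hα
  set β : SeqAlg A := r • b with hβ
  have hα1 : ‖E.expSeq (star α * α)‖ ≤ 1 := by
    have h1 : star α * α = w • (const ((star p : P) : A) * (e * const (p : A))) := by
      rw [hα, star_smul, star_mul, hse, star_trivial, smul_mul_assoc, mul_smul_comm, smul_smul,
        hsq, mul_assoc, he.mul_mul_const hA, hstar]
    have h2 : E.expSeq (star α * α) = const ((star p * p : P) : A) := by
      rw [h1, expSeq_real_smul, expSeq_const_mul, CondExpectation.expSeq_mul_const,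
        ← mul_smul_comm, he.expSeq_mul_const hA, ← map_mul]
      rfl
    rw [h2]
    refine (norm_const_le _).trans ?_
    change ‖star p * p‖ ≤ 1
    rw [CStarRing.norm_star_mul_self]
    exact mul_le_one₀ hp (norm_nonneg _) hp
  have hβ1 : ‖E.expSeq (star β * β)‖ ≤ 1 := by
    refine (E.norm_expSeq_le _).trans ?_
    rw [CStarRing.norm_star_mul_self, hβ, norm_smul, Real.norm_of_nonneg hr0.le]
    exact mul_le_one₀ hrb (by positivity) hrb
  have hαβ : E.expSeq (star α * β) = 0 := by
    rw [hα, hβ, star_smul, star_mul, hse, star_trivial, smul_mul_assoc, mul_smul_comm, smul_smul,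
      expSeq_real_smul, mul_assoc, ← hstar, hb, smul_zero]
  have hT := E.norm_pair_le_of_expSeq hw hα1 hβ1 hαβ
  set y : SeqAlg A := const x * e with hy
  -- the compression of `α α^* + β β^* ≤ w` by `x e`
  have hconj : y * (α * star α + β * star β) * star y ≤ w • (y * star y) :=
    (CStarAlgebra.star_right_conjugate_le_norm_smul
      ((IsSelfAdjoint.mul_star_self α).add (IsSelfAdjoint.mul_star_self β))).trans
      (smul_le_smul_of_nonneg_right hT (mul_star_self_nonneg y))
  have hye : y = e * const x := (he.commute x).eq
  have hyα : y * α = Real.sqrt w • (e * const (x * p)) := by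
    rw [hα, hy, mul_smul_comm, mul_assoc, he.const_mul_mul hA, ← mul_assoc, (he.commute x).eq,
      map_mul, mul_assoc]
  have hαα : y * α * star (y * α) = w • (e * const (x * p * star (x * p)) * e) := by
    rw [hyα, star_smul, star_mul, hse, star_trivial, smul_mul_assoc, mul_smul_comm, smul_smul, hsq,
      map_mul const (x * (p : A)), map_star]
    simp only [mul_assoc]
  have hyy : y * star y = e * const (x * star x) * e := by
    rw [hye, star_mul, hse, map_mul, map_star]
    simp only [mul_assoc]
  have hββ : y * β * star (y * β) ≤ w • (e * const (x * star x - x * p * star (x * p)) * e) := by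
    rw [hyy] at hconj
    have h1 : y * (α * star α + β * star β) * star y =
        y * α * star (y * α) + y * β * star (y * β) := by
      simp only [star_mul, mul_add, add_mul, mul_assoc]
    rw [h1, hαα, ← le_sub_iff_add_le'] at hconj
    rwa [map_sub, mul_sub, sub_mul, smul_sub]
  have hn := CStarAlgebra.norm_le_norm_of_nonneg_of_le (mul_star_self_nonneg (y * β)) hββ
  rw [CStarRing.norm_self_mul_star, norm_smul, Real.norm_of_nonneg hw0, hβ, mul_smul_comm, norm_smul,
    Real.norm_of_nonneg hr0.le, hy, mul_assoc (const x)] at hn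
  have hn' : ‖e * const (x * star x - x * p * star (x * p)) * e‖ ≤
      ‖x * star x - x * p * star (x * p)‖ := by
    refine (norm_mul_le _ _).trans ((mul_le_of_le_one_right (norm_nonneg _) he.norm_le_one).trans ?_)
    refine (norm_mul_le _ _).trans ((mul_le_of_le_one_left (norm_nonneg _) he.norm_le_one).trans ?_)
    exact norm_const_le _
  have hn'' := hn.trans (mul_le_mul_of_nonneg_left hn' hw0)
  have hrr : r * (‖b‖ + 1) = 1 := inv_mul_cancel₀ (by positivity)
  calc ‖const x * (e * b)‖ ^ 2
      = (‖b‖ + 1) ^ 2 * (r * ‖const x * (e * b)‖ * (r * ‖const x * (e * b)‖)) := by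
        linear_combination (-‖const x * (e * b)‖ ^ 2 * (r * (‖b‖ + 1) + 1)) * hrr
    _ ≤ (‖b‖ + 1) ^ 2 * (w * ‖x * star x - x * p * star (x * p)‖) := by gcongr
    _ = _ := by ring

/-- The push-down identity `e z = Index_w E • e E^∞ (e z)` for `z ∈ A`, after multiplication by
elements of `A`. -/
theorem const_mul_pushDown [StarOrderedRing A] (he : E.IsRokhlinElement e) (hA : IsSigmaUnital A)
    (hP : IsSigmaUnital P) (x z : A) :
    E.indexW • (const x * (e * E.expSeq (e * const z))) = const x * (e * const z) := by
  by_cases hw : E.indexW = 0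
  · simp [he.eq_zero_of_indexW_eq_zero hA hw x]
  obtain ⟨u, -, hu, hu'⟩ := hP
  set b : SeqAlg A := e * const z - E.indexW • (e * E.expSeq (e * const z)) with hb
  have hab (a : A) : const a * (e * b) =
      const a * (e * const z) - E.indexW • (const a * (e * E.expSeq (e * const z))) := by
    rw [hb, mul_sub, mul_sub, mul_smul_comm, mul_smul_comm, he.const_mul_mul hA,
      he.const_mul_mul hA]
  -- `b` is orthogonal to `e p` for every `p ∈ P`
  have horth (p : P) : E.expSeq (const (p : A) * (e * b)) = 0 := by
    rw [hab, map_sub, expSeq_real_smul, ← mul_assoc (const (p : A)) e (E.expSeq _),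
      expSeq_mul_expSeq, expSeq_const_mul, expSeq_const_mul, ← smul_mul_assoc,
      he.const_mul_expSeq hA, sub_self]
  have hux := he.tendsto_mul_approximateUnit hA (fun n => (hu n).2) (fun p => (hu' p).2) x
  have hlim : Tendsto (fun n => E.indexW * (‖b‖ + 1) ^ 2 *
      ‖x * star x - x * (u n : A) * star (x * (u n : A))‖) atTop (𝓝 0) := by
    have h := ((tendsto_const_nhds (x := x * star x)).sub (hux.mul hux.star)).norm.const_mul
      (E.indexW * (‖b‖ + 1) ^ 2)
    simpa using h
  have h0 : ‖const x * (e * b)‖ ^ 2 ≤ 0 := ge_of_tendsto hlim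
    (Eventually.of_forall fun n => he.norm_sq_le hA hw x (u n) (hu n).2 b (horth _))
  have h1 : const x * (e * b) = 0 := norm_eq_zero.1 (pow_eq_zero_iff two_ne_zero |>.1
    (le_antisymm h0 (sq_nonneg _)))
  rw [hab, sub_eq_zero] at h1
  exact h1.symm

end IsRokhlinElement

end CondExpectation

/-! ### The splitting homomorphism -/

/-- The inclusion `P^∞ ⊆ A^∞`. -/
def SeqAlg.inclusion {A : Type*} [NonUnitalCStarAlgebra A] (P : NonUnitalStarSubalgebra ℂ A)
    [IsClosed (P : Set A)] : SeqAlg P →⋆ₙₐ[ℂ] SeqAlg A where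
  toFun := SeqAlg.map (CondExpectation.inclusionL P)
  map_smul' := map_smul _
  map_zero' := map_zero _
  map_add' := map_add _
  map_mul' x y := by
    obtain ⟨x, rfl⟩ := mk_surjective x
    obtain ⟨y, rfl⟩ := mk_surjective y
    rfl
  map_star' x := by
    obtain ⟨x, rfl⟩ := mk_surjective x
    rfl

theorem SeqAlg.inclusion_const {A : Type*} [NonUnitalCStarAlgebra A]
    (P : NonUnitalStarSubalgebra ℂ A) [IsClosed (P : Set A)] (p : P) :
    SeqAlg.inclusion P (const p) = const (p : A) := rfl

theorem SeqAlg.inclusion_injective {A : Type*} [NonUnitalCStarAlgebra A]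
    (P : NonUnitalStarSubalgebra ℂ A) [IsClosed (P : Set A)] :
    Function.Injective (SeqAlg.inclusion P) := by
  intro x y h
  obtain ⟨x, rfl⟩ := mk_surjective x
  obtain ⟨y, rfl⟩ := mk_surjective y
  exact mk_eq_mk.2 (mk_eq_mk.1 h : _ ∈ nullSeq A)

namespace CondExpectation

open SeqAlg

variable {A : Type*} [NonUnitalCStarAlgebra A] [PartialOrder A]
  {P : NonUnitalStarSubalgebra ℂ A} [IsClosed (P : Set A)]

theorem inclusion_real_smul_map (E : CondExpectation P) (r : ℝ) (x : SeqAlg A) :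
    inclusion P (r • SeqAlg.map E.toContinuousLinearMap x) = r • E.expSeq x :=
  map_smul (inclusion P) (r : ℂ) (SeqAlg.map E.toContinuousLinearMap x)

variable [StarOrderedRing A] {E : CondExpectation P} {e : SeqAlg A}

/-- The map `A → P^∞`, `x ↦ Index_w E • E^∞ (e x)`, for a Rokhlin element `e`. It is a
`*`-homomorphism by the push-down identity. -/
def IsRokhlinElement.splitting (he : E.IsRokhlinElement e) (hA : IsSigmaUnital A)
    (hP : IsSigmaUnital P) : A →⋆ₙₐ[ℂ] SeqAlg P where
  toFun x := E.indexW • SeqAlg.map E.toContinuousLinearMap (e * const x)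
  map_smul' c x := by
    rw [map_smul, mul_smul_comm, map_smul, smul_comm]
    rfl
  map_zero' := by simp
  map_add' x y := by rw [map_add, mul_add, map_add, smul_add]
  map_mul' x y := by
    apply inclusion_injective P
    rw [map_mul (inclusion P), inclusion_real_smul_map, inclusion_real_smul_map,
      inclusion_real_smul_map, smul_mul_assoc, mul_smul_comm, ← expSeq_mul_expSeq]
    congr 1
    rw [← expSeq_real_smul, ← (he.commute x).eq, mul_assoc, he.const_mul_pushDown hA hP, ← mul_assoc,
      (he.commute x).eq, mul_assoc, map_mul const]
  map_star' x := by
    apply inclusion_injective P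
    rw [map_star (inclusion P), inclusion_real_smul_map, inclusion_real_smul_map, star_smul,
      star_trivial E.indexW, ← expSeq_star, star_mul, he.star_eq, ← map_star const, (he.commute _).eq]

theorem IsRokhlinElement.splitting_coe (he : E.IsRokhlinElement e) (hA : IsSigmaUnital A)
    (hP : IsSigmaUnital P) (p : P) : he.splitting hA hP (p : A) = const p := by
  apply inclusion_injective P
  refine (E.inclusion_real_smul_map _ _).trans ?_
  rw [inclusion_const, CondExpectation.expSeq_mul_const, he.expSeq_mul_const hA]

end CondExpectation

end

theorem mainTheorem2 {A : Type*} [NonUnitalCStarAlgebra A] [PartialOrder A] [StarOrderedRing A]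
    (P : NonUnitalStarSubalgebra ℂ A) [IsClosed (P : Set A)]
    (hA : IsSigmaUnital A) (hP : IsSigmaUnital P) (hsimple : IsSimpleCStar A)
    (E : CondExpectation P) (hfaithful : E.Faithful) (hindex : E.indexP < ⊤)
    (hRokhlin : E.HasRokhlinProperty) :
    IsSequentiallySplit (NonUnitalStarSubalgebraClass.subtype P) := by
  obtain ⟨e, he⟩ := hRokhlin
  exact ⟨he.splitting hA hP, he.splitting_coe hA hP⟩
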